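/- Consider a single user in discrete time. Content is updated in each slot independently with probability $p\in(0,1]$; the user requests it in each slot independently with probability $q\in(0,1]$. Let $C_a:\mathbb{N}\to[0,\infty)$ be a convex, strictly increasing age cost and $C_{av}(\tau)=\mathbb{E}[C_a(V)]$ with $V\sim\mathrm{Binomial}(\tau,p)$. The single-user problem is the Markov decision process with states $(\tau,s)$, where $\tau\in\{1,2,\dots\}$ is the time since the last fetch and $s\in\{0,1\}$ indicates a request, and actions $a\in\{0,1\}$ ($a=1$: fetch). With $\alpha,C_f,\lambda\in\mathbb{R}$ and $K:=\alpha C_f+\lambda$, the one-slot cost is $Ka+(1-a)\,s\,C_{av}(\tau)$; the next state is $(1,s')$ if $a=1$ and $(\tau+1,s')$ if $a=0$, where $s'\sim\mathrm{Bernoulli}(q)$ is independent of the past. The aim is to minimize $\lim_{T\to\infty}\frac1T\,\mathbb{E}\big[\sum_{t=1}^{T}\text{cost}_t\big]$ over all (randomized, history-dependent) policies. Call a policy optimal with optimal cost $\theta$ if from every initial state its limiting average cost exists and equals $\theta$, while the lower limit of the average cost of every policy is at least $\theta$. The Bellman equation is, for $h$ bounded below and $h_{av}(\tau):=q\,h(\tau,1)+(1-q)\,h(\tau,0)$,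 \[h(\tau,s)+\theta=\min\{K+h_{av}(1),\ s\,C_{av}(\tau)+h_{av}(\tau+1)\};\] its policy fetches in $(\tau,s)$ iff the first term is at most the second. Then there is a real $\theta$ such that the Bellman equation has a solution $(\theta,h)$, every solution $(\theta',h)$ has $\theta'=\theta$, and the following holds. 1. If $K\le 0$, the policy that always fetches is optimal with optimal cost $\theta$, and it is the policy of every Bellman solution. 2. If $K>0$, the function \[\tau\mapsto\frac{q\sum_{x=1}^{\tau-1}C_{av}(x)+K}{\tau+\frac{1-q}{q}},\qquad \tau\in\{1,2,\dots\},\] attains its minimum. For every minimizer $f(K)$, the policy that fetches in $(\tau,s)$ iff $s=1$ and $\tau\ge f(K)$ is optimal with optimal cost $\theta$. If $f(K)$ is the least minimizer, this is the policy of every Bellman solution. -/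

import Mathlib

open Filter Topology

namespace SingleUserFetch

noncomputable section

/-- The expected age cost `E[ca V]` for `V ~ Binomial(τ, p)`, where `τ` is the number of slots since
the last fetch and `p` is the update probability. -/
def avgAgeCost (ca : ℕ → ℝ) (p : unitInterval) (τ : ℕ) : ℝ :=
  ∫ v, ca v ∂(ProbabilityTheory.binomial τ p)

/-- States `(τ, s)`: `τ ≥ 1` is the time since the last fetch, `s` tells whether the user requests. -/
abbrev State := ℕ+ × Bool

/-- Past states and actions, the most recent first. The action `true` means that the content is
fetched. -/
abbrev History := List (State × Bool)

/-- Randomized history-dependent policies: the law of the action, given the past and the current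
state. -/
abbrev Policy := History → State → PMF Bool

/-- The deterministic stationary policy given by a decision rule. -/
def stationary (μ : State → Bool) : Policy := fun _ x => PMF.pure (μ x)

/-- A request occurs with probability `q`. -/
def requestLaw (q : unitInterval) : PMF Bool :=
  PMF.ofFintype (fun s => ENNReal.ofReal (if s then (q : ℝ) else 1 - q)) (by
    rw [Fintype.sum_bool]
    simp only [if_true, Bool.false_eq_true, if_false]
    rw [← ENNReal.ofReal_add q.2.1 (sub_nonneg.2 q.2.2)]
    simp)

/-- The law of the next state: the time since the last fetch becomes `1` after a fetch and grows by
`1` otherwise; the next request is drawn afresh. -/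
def nextState (q : unitInterval) (x : State) (a : Bool) : PMF State :=
  (requestLaw q).map fun s => (if a then 1 else x.1 + 1, s)

/-- The joint law of the past and the current state after `t` transitions from the state `x`. -/
def trajectoryLaw (q : unitInterval) (π : Policy) (x : State) : ℕ → PMF (History × State)
  | 0 => PMF.pure ([], x)
  | t + 1 => (trajectoryLaw q π x t).bind fun z =>
      (π z.1 z.2).bind fun a =>
        (nextState q z.2 a).map fun y => ((z.2, a) :: z.1, y)

/-- The law of the state and the action after `t` transitions. -/
def stateActionLaw (q : unitInterval) (π : Policy) (x : State) (t : ℕ) : PMF (State × Bool) :=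
  (trajectoryLaw q π x t).bind fun z => (π z.1 z.2).map fun a => (z.2, a)

/-- The laws above have finite support, so the expectations below are finite sums. -/
theorem stateActionLaw_support_finite (q : unitInterval) (π : Policy) (x : State) (t : ℕ) :
    (stateActionLaw q π x t).support.Finite := by
  have h : ∀ t, (trajectoryLaw q π x t).support.Finite := by
    intro t
    induction t with
    | zero => simp [trajectoryLaw]
    | succ t ih =>
      simp only [trajectoryLaw, nextState, PMF.support_bind, PMF.support_map]
      exact ih.biUnion fun z _ => (Set.toFinite _).biUnion fun a _ =>
        ((Set.toFinite _).image _).image _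
  simp only [stateActionLaw, PMF.support_bind, PMF.support_map]
  exact (h t).biUnion fun z _ => (Set.toFinite _).image _

/-- The expectation of a real function under a discrete law. -/
def expect {X : Type*} (P : PMF X) (f : X → ℝ) : ℝ := ∑' x, (P x).toReal * f x

/-- The single-stage cost `K a + (1 - a) s C(τ)` with fetch cost `K` and age cost `C`. -/
def stageCost (C : ℕ → ℝ) (K : ℝ) (x : State) (a : Bool) : ℝ :=
  if a then K else if x.2 then C x.1 else 0

/-- The expected cost per slot over the first `T` slots, from the initial state `x`. -/
def averageCost (q : unitInterval) (C : ℕ → ℝ) (K : ℝ) (π : Policy) (x : State) (T : ℕ) : ℝ :=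
  (1 / (T : ℝ)) *
    ∑ t ∈ Finset.range T, expect (stateActionLaw q π x t) fun z => stageCost C K z.1 z.2

/-- The policy `π` is average-cost optimal with optimal cost `θ`: from every initial state its
long-run average cost exists and equals `θ`, and no policy has a smaller long-run average cost (even
in the sense of the lower limit). -/
def IsAverageOptimal (q : unitInterval) (C : ℕ → ℝ) (K : ℝ) (θ : ℝ) (π : Policy) : Prop :=
  ∀ x : State,
    Tendsto (averageCost q C K π x) atTop (𝓝 θ) ∧
      ∀ π' : Policy, (θ : EReal) ≤ liminf (fun T => (averageCost q C K π' x T : EReal)) atTop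

/-- The mean of `h (τ, s)` over a fresh request `s`. -/
def requestMean (q : unitInterval) (h : State → ℝ) (τ : ℕ+) : ℝ :=
  (q : ℝ) * h (τ, true) + (1 - (q : ℝ)) * h (τ, false)

/-- The cost of the action `a` in the state `x`, followed by the relative cost `h`. -/
def actionValue (q : unitInterval) (C : ℕ → ℝ) (K : ℝ) (h : State → ℝ) (x : State) (a : Bool) : ℝ :=
  stageCost C K x a + requestMean q h (if a then 1 else x.1 + 1)

/-- `θ` and the relative cost function `h`, bounded below, solve the average-cost Bellman
equation. -/
def IsBellmanSolution (q : unitInterval) (C : ℕ → ℝ) (K : ℝ) (θ : ℝ) (h : State → ℝ) : Prop :=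
  BddBelow (Set.range h) ∧
    ∀ x : State, h x + θ = min (actionValue q C K h x true) (actionValue q C K h x false)

/-- The decision rule read off from the Bellman equation: fetch iff fetching attains the minimum. -/
def IsBellmanRule (q : unitInterval) (C : ℕ → ℝ) (K : ℝ) (h : State → ℝ) (μ : State → Bool) :
    Prop :=
  ∀ x : State, μ x = true ↔ actionValue q C K h x true ≤ actionValue q C K h x false

/-- The renewal cost ratio `(q ∑_{x<τ} C(x) + K) / (τ + (1 - q) / q)`, the sum over `1 ≤ x < τ`. -/
def renewalRatio (q : unitInterval) (C : ℕ → ℝ) (K : ℝ) (τ : ℕ+) : ℝ :=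
  ((q : ℝ) * ∑ x ∈ Finset.Ico 1 (τ : ℕ), C x + K) / ((τ : ℝ) + (1 - (q : ℝ)) / (q : ℝ))

/-- The set of minimizers of the renewal cost ratio. -/
def renewalArgmin (q : unitInterval) (C : ℕ → ℝ) (K : ℝ) : Set ℕ+ :=
  {m | ∀ τ : ℕ+, renewalRatio q C K m ≤ renewalRatio q C K τ}

/-- The rule that always fetches. -/
def alwaysFetch : State → Bool := fun _ => true

/-- The rule that fetches iff the user requests and `τ ≥ m`. -/
def thresholdRule (m : ℕ+) : State → Bool := fun x => decide (m ≤ x.1) && x.2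

end

end SingleUserFetch

/-!
The proof compares every policy with a bounded solution `(θ, h)` of the Bellman equation. A solution
is automatically bounded above, because fetching costs at most `K` plus a constant. Telescoping the
expected relative cost `h` along a trajectory shows that `T` slots cost at least `T θ - O(1)` under
any policy, and exactly `T θ + O(1)` under a stationary rule that attains the Bellman minimum
(`IsBellmanSolution.isAverageOptimal`). In particular all solutions share the constant `θ`.

About the age cost `C` only three facts matter: it is nonnegative, monotone and unbounded. They follow
from the identity `C (τ + 1) - C τ = p E[ca (V + 1) - ca V]` with `V ~ Binomial(τ, p)`, whose right side
is at least `p (ca 1 - ca 0) > 0` by convexity.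

For `K ≤ 0` the pair `(K, 0)` is a solution. For `K > 0` the renewal ratio `r` satisfies: `r (τ + 1)` is
a weighted mean of `r τ` and `q C τ`. Hence at a minimizer `m`, with `θ = r m`, one has `q C τ ≤ θ` for
`τ < m` and `θ ≤ q C τ` for `τ ≥ m`, and
`h_av τ = K - θ / q - ∑_{τ ≤ x < m} (θ - q C x)` defines a solution, normalized by `h_av 1 = 0`; the
normalization is exactly the equation `θ = r m`. The threshold rule at `m` attains its minimum.

For an arbitrary solution with `K > 0` let `v τ = K + h_av 1 - h_av τ`; fetching is preferred in `(τ, s)` iff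
`v (τ + 1) ≤ s C τ`. The Bellman equation becomes `v τ = θ + v (τ + 1) - q min (v (τ + 1)) (C τ)`. As `v`
is bounded and `C` is not, this is eventually the recursion `v τ = θ + (1 - q) v (τ + 1)`, whose only
bounded solution is `θ / q`. Backward induction then gives `v ≥ θ / q`, with equality at all `τ` with
`q C τ ≥ θ`; hence fetching is preferred iff `s = 1` and `q C τ ≥ θ`, which is the threshold rule of
the least minimizer.
-/

namespace SingleUserFetch

/-! ### Expectations under discrete laws of finite support -/

section Expect

variable {X Y : Type*}

lemma expect_eq_sum (P : PMF X) (f : X → ℝ) {s : Finset X} (hs : P.support ⊆ s) :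
    expect P f = ∑ x ∈ s, (P x).toReal * f x := by
  refine tsum_eq_sum fun x hx => ?_
  have : P x = 0 := (P.apply_eq_zero_iff x).2 fun h => hx (hs h)
  simp [this]

lemma expect_pure (x : X) (f : X → ℝ) : expect (PMF.pure x) f = f x := by
  rw [expect_eq_sum (PMF.pure x) f (s := {x}) (by simp)]
  simp

lemma expect_bind (P : PMF X) (κ : X → PMF Y) (f : Y → ℝ) (hP : P.support.Finite)
    (hκ : ∀ x, (κ x).support.Finite) :
    expect (P.bind κ) f = expect P fun x => expect (κ x) f := by
  have hU : (⋃ x ∈ P.support, (κ x).support).Finite := hP.biUnion fun x _ => hκ x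
  have hκU : ∀ x ∈ hP.toFinset, expect (κ x) f = ∑ y ∈ hU.toFinset, (κ x y).toReal * f y := by
    intro x hx
    refine expect_eq_sum _ _ ?_
    rw [hU.coe_toFinset]
    exact Set.subset_biUnion_of_mem (u := fun x => (κ x).support) (hP.mem_toFinset.1 hx)
  have hbind : ∀ y, (P.bind κ y).toReal = ∑ x ∈ hP.toFinset, (P x).toReal * (κ x y).toReal := by
    intro y
    rw [PMF.bind_apply, tsum_eq_sum (s := hP.toFinset), ENNReal.toReal_sum]
    · simp
    · exact fun x _ => ENNReal.mul_ne_top (P.apply_ne_top x) ((κ x).apply_ne_top y)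
    · intro x hx
      have : P x = 0 := (P.apply_eq_zero_iff x).2 fun h => hx (hP.mem_toFinset.2 h)
      simp [this]
  rw [expect_eq_sum (P.bind κ) f (s := hU.toFinset) (by simp [PMF.support_bind]),
    expect_eq_sum P _ (s := hP.toFinset) (by simp)]
  simp_rw [hbind, Finset.sum_mul]
  rw [Finset.sum_comm]
  refine Finset.sum_congr rfl fun x hx => ?_
  rw [hκU x hx, Finset.mul_sum]
  exact Finset.sum_congr rfl fun y _ => mul_assoc _ _ _

lemma expect_map (P : PMF X) (g : X → Y) (f : Y → ℝ) (hP : P.support.Finite) :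
    expect (P.map g) f = expect P fun x => f (g x) := by
  rw [← PMF.bind_pure_comp, expect_bind P _ f hP (by simp)]
  simp [expect_pure]

lemma expect_add (P : PMF X) (f g : X → ℝ) (hP : P.support.Finite) :
    expect P (fun x => f x + g x) = expect P f + expect P g := by
  simp_rw [expect_eq_sum P _ (s := hP.toFinset) (by simp), mul_add, Finset.sum_add_distrib]

lemma expect_const (P : PMF X) (c : ℝ) : expect P (fun _ => c) = c := by
  unfold expect
  rw [tsum_mul_right, ← ENNReal.tsum_toReal_eq fun x => P.apply_ne_top x, P.tsum_coe]
  simp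

lemma expect_mono (P : PMF X) {f g : X → ℝ} (hP : P.support.Finite) (h : ∀ x, f x ≤ g x) :
    expect P f ≤ expect P g := by
  simp_rw [expect_eq_sum P _ (s := hP.toFinset) (by simp)]
  exact Finset.sum_le_sum fun x _ => mul_le_mul_of_nonneg_left (h x) ENNReal.toReal_nonneg

end Expect

/-! ### The verification theorem -/

lemma nextState_support_finite (q : unitInterval) (x : State) (a : Bool) :
    (nextState q x a).support.Finite := by
  rw [nextState, PMF.support_map]
  exact (Set.toFinite _).image _

lemma trajectoryLaw_support_finite (q : unitInterval) (π : Policy) (x : State) (t : ℕ) :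
    (trajectoryLaw q π x t).support.Finite := by
  induction t with
  | zero => simp [trajectoryLaw]
  | succ t ih =>
    simp only [trajectoryLaw, nextState, PMF.support_bind, PMF.support_map]
    exact ih.biUnion fun z _ => (Set.toFinite _).biUnion fun a _ =>
      ((Set.toFinite _).image _).image _

lemma expect_nextState (q : unitInterval) (x : State) (a : Bool) (h : State → ℝ) :
    expect (nextState q x a) h = requestMean q h (if a then 1 else x.1 + 1) := by
  rw [nextState, expect_map _ _ _ (Set.toFinite _),
    expect_eq_sum _ _ (s := Finset.univ) (by rw [Finset.coe_univ]; exact Set.subset_univ _),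
    Fintype.sum_bool]
  simp [requestLaw, PMF.ofFintype_apply, requestMean, q.2.1, q.2.2]

lemma expect_trajectoryLaw_succ (q : unitInterval) (π : Policy) (x : State) (t : ℕ) (h : State → ℝ) :
    expect (trajectoryLaw q π x (t + 1)) (fun z => h z.2) =
      expect (trajectoryLaw q π x t) fun z =>
        expect (π z.1 z.2) fun a => requestMean q h (if a then 1 else z.2.1 + 1) := by
  have hfin : ∀ (z : History × State) (a : Bool),
      ((nextState q z.2 a).map fun y => ((z.2, a) :: z.1, y)).support.Finite := fun z a => by
    rw [PMF.support_map]
    exact (nextState_support_finite q z.2 a).image _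
  rw [trajectoryLaw, expect_bind _ _ _ (trajectoryLaw_support_finite q π x t)]
  · congr 1
    funext z
    rw [expect_bind _ _ _ (Set.toFinite _) (hfin z)]
    congr 1
    funext a
    rw [expect_map _ _ _ (nextState_support_finite q z.2 a), ← expect_nextState]
  · intro z
    rw [PMF.support_bind]
    exact (Set.toFinite _).biUnion fun a _ => hfin z a

lemma expect_stateActionLaw (q : unitInterval) (π : Policy) (x : State) (t : ℕ)
    (f : State × Bool → ℝ) :
    expect (stateActionLaw q π x t) f =
      expect (trajectoryLaw q π x t) fun z => expect (π z.1 z.2) fun a => f (z.2, a) := by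
  rw [stateActionLaw, expect_bind _ _ _ (trajectoryLaw_support_finite q π x t)]
  · congr 1
    funext z
    rw [expect_map _ _ _ (Set.toFinite _)]
  · intro z
    rw [PMF.support_map]
    exact (Set.toFinite _).image _

/-- One step of the telescoping: the cost of slot `t` plus the relative cost at time `t + 1` is the
mean action value at time `t`. -/
lemma expect_stageCost_add_expect_succ (q : unitInterval) (C : ℕ → ℝ) (K : ℝ) (π : Policy) (x : State)
    (t : ℕ) (h : State → ℝ) :
    expect (stateActionLaw q π x t) (fun z => stageCost C K z.1 z.2) +
        expect (trajectoryLaw q π x (t + 1)) (fun z => h z.2) =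
      expect (trajectoryLaw q π x t) fun z =>
        expect (π z.1 z.2) fun a => actionValue q C K h z.2 a := by
  rw [expect_trajectoryLaw_succ, expect_stateActionLaw,
    ← expect_add _ _ _ (trajectoryLaw_support_finite q π x t)]
  congr 1
  funext z
  rw [← expect_add _ _ _ (Set.toFinite _)]
  rfl

section Verification

variable {q : unitInterval} {C : ℕ → ℝ} {K θ : ℝ} {h : State → ℝ}

lemma le_sum_stageCost (hle : ∀ x a, h x + θ ≤ actionValue q C K h x a) (π : Policy) (x : State)
    (T : ℕ) :
    T * θ + h x ≤
      ∑ t ∈ Finset.range T, expect (stateActionLaw q π x t) (fun z => stageCost C K z.1 z.2) +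
        expect (trajectoryLaw q π x T) (fun z => h z.2) := by
  induction T with
  | zero => simp [trajectoryLaw, expect_pure]
  | succ T ih =>
    have hfin := trajectoryLaw_support_finite q π x T
    have hstep : expect (trajectoryLaw q π x T) (fun z => h z.2) + θ ≤
        expect (trajectoryLaw q π x T) fun z =>
          expect (π z.1 z.2) fun a => actionValue q C K h z.2 a := by
      rw [← expect_const (trajectoryLaw q π x T) θ, ← expect_add _ _ _ hfin]
      refine expect_mono _ hfin fun z => ?_
      rw [← expect_const (π z.1 z.2) (h z.2 + θ)]
      exact expect_mono _ (Set.toFinite _) fun a => hle z.2 a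
    rw [← expect_stageCost_add_expect_succ] at hstep
    rw [Finset.sum_range_succ]
    push_cast
    linarith

lemma sum_stageCost_stationary {μ : State → Bool}
    (hμ : ∀ x, actionValue q C K h x (μ x) = h x + θ) (x : State) (T : ℕ) :
    ∑ t ∈ Finset.range T,
        expect (stateActionLaw q (stationary μ) x t) (fun z => stageCost C K z.1 z.2) +
        expect (trajectoryLaw q (stationary μ) x T) (fun z => h z.2) = T * θ + h x := by
  induction T with
  | zero => simp [trajectoryLaw, expect_pure]
  | succ T ih =>
    have hfin := trajectoryLaw_support_finite q (stationary μ) x T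
    have hstep := expect_stageCost_add_expect_succ q C K (stationary μ) x T h
    simp only [stationary, expect_pure, hμ] at hstep
    rw [expect_add _ _ _ hfin, expect_const] at hstep
    rw [Finset.sum_range_succ]
    push_cast
    linarith

lemma IsBellmanSolution.le_actionValue (hs : IsBellmanSolution q C K θ h) (x : State) (a : Bool) :
    h x + θ ≤ actionValue q C K h x a := by
  rw [hs.2 x]
  cases a
  · exact min_le_right _ _
  · exact min_le_left _ _

/-- Fetching is always available, so a relative cost function is bounded above. -/
lemma IsBellmanSolution.le_fetch (hs : IsBellmanSolution q C K θ h) (x : State) :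
    h x ≤ K + requestMean q h 1 - θ := by
  have := hs.le_actionValue x true
  simp only [actionValue, stageCost, if_true] at this
  linarith

/-- A stationary rule that attains the minimum in a Bellman equation is average-cost optimal. -/
lemma IsBellmanSolution.isAverageOptimal (hs : IsBellmanSolution q C K θ h) {μ : State → Bool}
    (hμ : ∀ x, actionValue q C K h x (μ x) = h x + θ) :
    IsAverageOptimal q C K θ (stationary μ) := by
  intro x
  obtain ⟨b, hb⟩ := hs.1
  have hb' : ∀ y, b ≤ h y := fun y => hb ⟨y, rfl⟩
  set B := K + requestMean q h 1 - θ with hB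
  have hlim : ∀ c : ℝ, Tendsto (fun T : ℕ => θ + c / (T : ℝ)) atTop (𝓝 θ) := fun c => by
    simpa using tendsto_const_nhds.add (tendsto_const_div_atTop_nhds_zero_nat c)
  have hlower : ∀ (π : Policy) (T : ℕ), 0 < T →
      θ + (h x - B) / (T : ℝ) ≤ averageCost q C K π x T := by
    intro π T hT
    have hT' : (0 : ℝ) < T := by exact_mod_cast hT
    have h1 := le_sum_stageCost hs.le_actionValue π x T
    have h2 := expect_mono (trajectoryLaw q π x T) (trajectoryLaw_support_finite q π x T)
      fun z => hs.le_fetch z.2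
    rw [expect_const] at h2
    rw [averageCost, one_div_mul_eq_div, le_div_iff₀ hT', add_mul, div_mul_cancel₀ _ hT'.ne']
    linarith
  refine ⟨?_, fun π' => ?_⟩
  · refine tendsto_of_tendsto_of_tendsto_of_le_of_le' (hlim (h x - B)) (hlim (h x - b)) ?_ ?_
    · filter_upwards [eventually_gt_atTop 0] with T hT using hlower _ T hT
    · filter_upwards [eventually_gt_atTop 0] with T hT
      have hT' : (0 : ℝ) < T := by exact_mod_cast hT
      have h1 := sum_stageCost_stationary hμ x T
      have h2 := expect_mono (trajectoryLaw q (stationary μ) x T)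
        (trajectoryLaw_support_finite q (stationary μ) x T) fun z => hb' z.2
      rw [expect_const] at h2
      rw [averageCost, one_div_mul_eq_div, div_le_iff₀ hT', add_mul, div_mul_cancel₀ _ hT'.ne']
      linarith
  · have hE : Tendsto (fun T : ℕ => ((θ + (h x - B) / (T : ℝ) : ℝ) : EReal)) atTop
        (𝓝 (θ : EReal)) :=
      (continuous_coe_real_ereal.tendsto θ).comp (hlim _)
    rw [← hE.liminf_eq]
    refine liminf_le_liminf ?_
    filter_upwards [eventually_gt_atTop 0] with T hT
    exact_mod_cast hlower π' T hT

/-- A rule that attains the minimum in the Bellman equation always exists. -/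
lemma IsBellmanSolution.exists_greedy (hs : IsBellmanSolution q C K θ h) :
    ∃ μ : State → Bool, ∀ x, actionValue q C K h x (μ x) = h x + θ := by
  have : ∀ x, ∃ a : Bool, actionValue q C K h x a = h x + θ := fun x => by
    rw [hs.2 x]
    rcases min_choice (actionValue q C K h x true) (actionValue q C K h x false) with e | e
    · exact ⟨true, e.symm⟩
    · exact ⟨false, e.symm⟩
  exact Classical.skolem.1 this

lemma IsAverageOptimal.cost_le {θ' : ℝ} {π π' : Policy} (ho : IsAverageOptimal q C K θ π)
    (ho' : IsAverageOptimal q C K θ' π') : θ ≤ θ' := by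
  have h1 := (ho (1, true)).2 π'
  have h2 : Tendsto (fun T => (averageCost q C K π' (1, true) T : EReal)) atTop (𝓝 (θ' : EReal)) :=
    (continuous_coe_real_ereal.tendsto θ').comp (ho' (1, true)).1
  rw [h2.liminf_eq] at h1
  exact_mod_cast h1

/-- The constant in the Bellman equation is the optimal average cost, hence unique. -/
lemma IsBellmanSolution.constant_unique {θ' : ℝ} {h' : State → ℝ} (hs : IsBellmanSolution q C K θ h)
    (hs' : IsBellmanSolution q C K θ' h') : θ' = θ := by
  obtain ⟨μ, hμ⟩ := hs.exists_greedy
  obtain ⟨μ', hμ'⟩ := hs'.exists_greedy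
  have ho := hs.isAverageOptimal hμ
  have ho' := hs'.isAverageOptimal hμ'
  exact le_antisymm (ho'.cost_le ho) (ho.cost_le ho')

end Verification

/-! ### The expected age cost -/

section AgeCost

variable (ca : ℕ → ℝ) (p : unitInterval)

/-- Conditioning on the last of `n + 1` trials. -/
lemma avgAgeCost_succ (n : ℕ) :
    avgAgeCost ca p (n + 1) =
      (1 - (p : ℝ)) * avgAgeCost ca p n + p * avgAgeCost (fun k => ca (k + 1)) p n := by
  have key : ∀ (f : ℕ → ℝ) (n : ℕ), avgAgeCost f p n =
      ∑ ij ∈ Finset.HasAntidiagonal.antidiagonal n, n.choose ij.1 • ((p : ℝ) ^ ij.1 * (1 - p) ^ ij.2 * f ij.1) := by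
    intro f n
    rw [avgAgeCost, ProbabilityTheory.integral_binomial, Finset.Nat.sum_antidiagonal_eq_sum_range_succ
      (fun i j => n.choose i • ((p : ℝ) ^ i * (1 - p) ^ j * f i)), ← Nat.range_succ_eq_Iic]
    refine Finset.sum_congr rfl fun k _ => ?_
    simp only [smul_eq_mul, nsmul_eq_mul]
    ring
  rw [key, key, key, Finset.sum_antidiagonal_choose_succ_nsmul
    (fun i j => (p : ℝ) ^ i * (1 - p) ^ j * ca i), Finset.mul_sum, Finset.mul_sum]
  congr 1
  · refine Finset.sum_congr rfl fun ij _ => ?_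
    simp only [nsmul_eq_mul]
    ring
  · refine Finset.sum_congr rfl fun ij hij => ?_
    rw [Nat.choose_symm_of_eq_add (Finset.HasAntidiagonal.mem_antidiagonal.1 hij).symm]
    simp only [nsmul_eq_mul]
    ring

variable {ca} {p}

lemma avgAgeCost_add_le_succ (ca_convex : ∀ n : ℕ, ca (n + 1) - ca n ≤ ca (n + 2) - ca (n + 1))
    (n : ℕ) : avgAgeCost ca p n + p * (ca 1 - ca 0) ≤ avgAgeCost ca p (n + 1) := by
  have hinc : ∀ k, ca 1 - ca 0 ≤ ca (k + 1) - ca k := by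
    intro k
    induction k with
    | zero => simp
    | succ k ih => exact ih.trans (ca_convex k)
  have hint : ca 1 - ca 0 ≤ avgAgeCost (fun k => ca (k + 1)) p n - avgAgeCost ca p n := by
    rw [avgAgeCost, avgAgeCost, ← MeasureTheory.integral_sub
      (ProbabilityTheory.integrable_binomial _) (ProbabilityTheory.integrable_binomial _)]
    have := MeasureTheory.integral_mono (μ := ProbabilityTheory.binomial n p)
      (ProbabilityTheory.integrable_binomial fun _ => ca 1 - ca 0)
      (ProbabilityTheory.integrable_binomial fun k => ca (k + 1) - ca k) hinc
    simpa using this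
  rw [avgAgeCost_succ]
  nlinarith [mul_le_mul_of_nonneg_left hint p.2.1]

lemma avgAgeCost_nonneg (ca_nonneg : 0 ≤ ca 0) (ca_mono : Monotone ca) (n : ℕ) :
    0 ≤ avgAgeCost ca p n :=
  MeasureTheory.integral_nonneg fun k => ca_nonneg.trans (ca_mono (Nat.zero_le k))

lemma avgAgeCost_monotone (ca_mono : Monotone ca)
    (ca_convex : ∀ n : ℕ, ca (n + 1) - ca n ≤ ca (n + 2) - ca (n + 1)) :
    Monotone (avgAgeCost ca p) :=
  monotone_nat_of_le_succ fun n => by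
    have h1 := avgAgeCost_add_le_succ (p := p) ca_convex n
    have h2 := mul_nonneg p.2.1 (sub_nonneg.2 (ca_mono zero_le_one))
    linarith

lemma avgAgeCost_tendsto_atTop (ca_nonneg : 0 ≤ ca 0) (ca_strictMono : StrictMono ca)
    (ca_convex : ∀ n : ℕ, ca (n + 1) - ca n ≤ ca (n + 2) - ca (n + 1)) (hp : 0 < p) :
    Tendsto (avgAgeCost ca p) atTop atTop := by
  have hp' : (0 : ℝ) < p := hp
  have hlin : ∀ n : ℕ, n * ((p : ℝ) * (ca 1 - ca 0)) ≤ avgAgeCost ca p n := by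
    intro n
    induction n with
    | zero => simpa using avgAgeCost_nonneg (p := p) ca_nonneg ca_strictMono.monotone 0
    | succ n ih =>
      have := avgAgeCost_add_le_succ (p := p) ca_convex n
      push_cast
      linarith
  exact tendsto_atTop_mono hlin (tendsto_natCast_atTop_atTop.atTop_mul_const
    (mul_pos hp' (sub_pos.2 (ca_strictMono zero_lt_one))))

end AgeCost

/-! ### The renewal cost ratio -/

section Renewal

variable {q : unitInterval} {C : ℕ → ℝ} {K : ℝ}

/-- The denominator of the renewal ratio is the mean length of a cycle of the threshold rule. For
`q = 0` the quotient is `0` by convention, so positivity holds there as well. -/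
lemma renewalRatio_denom_pos (q : unitInterval) (τ : ℕ+) : 0 < (τ : ℝ) + (1 - (q : ℝ)) / (q : ℝ) := by
  have h1 : (0 : ℝ) < τ := by exact_mod_cast τ.pos
  have h2 : 0 ≤ (1 - (q : ℝ)) / (q : ℝ) := div_nonneg (sub_nonneg.2 q.2.2) q.2.1
  linarith

/-- The ratio at `τ + 1` is the mean of the ratio at `τ`, with the weight of the denominator, and of
`q C τ`, with weight one. -/
lemma renewalRatio_succ_mul (τ : ℕ+) :
    renewalRatio q C K (τ + 1) * ((τ : ℝ) + (1 - (q : ℝ)) / (q : ℝ) + 1) =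
      renewalRatio q C K τ * ((τ : ℝ) + (1 - (q : ℝ)) / (q : ℝ)) + q * C τ := by
  have h1 := renewalRatio_denom_pos q τ
  have h2 := renewalRatio_denom_pos q (τ + 1)
  have h3 : (((τ + 1 : ℕ+) : ℕ) : ℝ) + (1 - (q : ℝ)) / (q : ℝ) =
      (τ : ℝ) + (1 - (q : ℝ)) / (q : ℝ) + 1 := by
    push_cast
    ring
  unfold renewalRatio
  rw [← h3, div_mul_cancel₀ _ h2.ne', div_mul_cancel₀ _ h1.ne', PNat.add_coe, PNat.one_coe,
    Finset.sum_Ico_succ_top (Nat.one_le_iff_ne_zero.2 τ.ne_zero)]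
  ring

lemma renewalRatio_pos (hC0 : ∀ n, 0 ≤ C n) (hK : 0 < K) (τ : ℕ+) :
    0 < renewalRatio q C K τ :=
  div_pos (add_pos_of_nonneg_of_pos (mul_nonneg q.2.1 (Finset.sum_nonneg fun x _ => hC0 x)) hK)
    (renewalRatio_denom_pos q τ)

/-- Beyond the point where `q C` exceeds the first ratio, the ratios cannot fall below the minimum
over the earlier ones. -/
lemma renewalArgmin_nonempty (hq : 0 < q) (hC : Tendsto C atTop atTop) :
    (renewalArgmin q C K).Nonempty := by
  have hq' : (0 : ℝ) < q := hq
  obtain ⟨N, hN⟩ := eventually_atTop.1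
    (hC.eventually_ge_atTop (renewalRatio q C K 1 / q))
  obtain ⟨m, -, hm⟩ := Finset.exists_min_image (Finset.Icc 1 N.succPNat) (renewalRatio q C K)
    ⟨1, by simp⟩
  refine ⟨m, fun τ => ?_⟩
  induction τ using PNat.recOn with
  | one => exact hm 1 (by simp)
  | succ τ ih =>
    rcases le_or_gt (τ + 1) N.succPNat with hle | hlt
    · exact hm _ (Finset.mem_Icc.2 ⟨one_le, hle⟩)
    · have hNτ : N ≤ τ := by
        have : ((N.succPNat : ℕ+) : ℕ) < ((τ + 1 : ℕ+) : ℕ) := hlt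
        simp at this
        omega
      have h1 := (div_le_iff₀' hq').1 (hN _ hNτ)
      have h2 := hm 1 (by simp)
      have hd := renewalRatio_denom_pos q τ
      have h3 := renewalRatio_succ_mul (q := q) (C := C) (K := K) τ
      have h4 := mul_le_mul_of_nonneg_right ih hd.le
      refine le_of_mul_le_mul_right ?_ (add_pos hd one_pos)
      linarith

lemma renewalRatio_le_of_ge (hmono : Monotone C) {m : ℕ+}
    (hm : m ∈ renewalArgmin q C K) {τ : ℕ+} (hτ : m ≤ τ) : renewalRatio q C K m ≤ q * C τ := by
  have hd := renewalRatio_denom_pos q m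
  have h1 := renewalRatio_succ_mul (q := q) (C := C) (K := K) m
  have h2 := mul_le_mul_of_nonneg_right (hm (m + 1)) (add_pos hd one_pos).le
  have h3 : (q : ℝ) * C m ≤ q * C τ := mul_le_mul_of_nonneg_left (hmono hτ) q.2.1
  linarith

lemma le_renewalRatio_of_lt (hmono : Monotone C) {m : ℕ+}
    (hm : m ∈ renewalArgmin q C K) {τ : ℕ+} (hτ : τ < m) : q * C τ ≤ renewalRatio q C K m := by
  obtain ⟨n, rfl⟩ := PNat.exists_eq_succ_of_ne_one (one_le.trans_lt hτ).ne'
  have hd := renewalRatio_denom_pos q n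
  have h1 := renewalRatio_succ_mul (q := q) (C := C) (K := K) n
  have h2 := mul_le_mul_of_nonneg_right (hm n) hd.le
  have h3 : (q : ℝ) * C τ ≤ q * C n :=
    mul_le_mul_of_nonneg_left (hmono (PNat.lt_add_one_iff.1 hτ)) q.2.1
  linarith

lemma lt_renewalRatio_of_lt_isLeast (hmono : Monotone C) {m : ℕ+}
    (hm : IsLeast (renewalArgmin q C K) m) {τ : ℕ+} (hτ : τ < m) :
    q * C τ < renewalRatio q C K m := by
  obtain ⟨n, rfl⟩ := PNat.exists_eq_succ_of_ne_one (one_le.trans_lt hτ).ne'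
  have hd := renewalRatio_denom_pos q n
  have h1 := renewalRatio_succ_mul (q := q) (C := C) (K := K) n
  -- The predecessor of the least minimizer is not a minimizer, so its ratio is strictly larger.
  have hlt : renewalRatio q C K (n + 1) < renewalRatio q C K n := by
    by_contra hle
    have : n ∈ renewalArgmin q C K := fun σ => (not_lt.1 hle).trans (hm.1 σ)
    exact absurd (hm.2 this) (not_le.2 (PNat.lt_add_right n 1))
  have h2 := mul_lt_mul_of_pos_right hlt hd
  have h3 : (q : ℝ) * C τ ≤ q * C n :=
    mul_le_mul_of_nonneg_left (hmono (PNat.lt_add_one_iff.1 hτ)) q.2.1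
  linarith

end Renewal

/-! ### Explicit solutions of the Bellman equation -/

section Existence

variable {q : unitInterval} {C : ℕ → ℝ} {K : ℝ}

lemma isBellmanSolution_zero (hC0 : ∀ n, 0 ≤ C n) (hK : K ≤ 0) :
    IsBellmanSolution q C K K (fun _ => 0) ∧
      ∀ x, actionValue q C K (fun _ => 0) x (alwaysFetch x) = 0 + K := by
  refine ⟨⟨⟨0, by rintro _ ⟨_, rfl⟩; exact le_rfl⟩, fun x => ?_⟩, fun x => ?_⟩
  · have h0 : 0 ≤ if x.2 then C x.1 else 0 := by
      split_ifs
      exacts [hC0 _, le_rfl]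
    simp only [actionValue, stageCost, requestMean, if_true, Bool.false_eq_true, if_false,
      mul_zero, add_zero, zero_add]
    rw [min_eq_left (hK.trans h0)]
  · simp [actionValue, stageCost, requestMean, alwaysFetch]

/-- The amount `K - h_av τ` by which the relative cost of the threshold rule at `m` lies below the
fetch cost, when `h_av 1 = 0`. With `θ` the renewal ratio at `m`, it is `θ` times the mean number
`1 / q` of slots up to the next request if `τ ≥ m`, and each slot `x < m` still to be passed adds its
surplus `θ - q C x`. -/
noncomputable def thresholdGap (q : unitInterval) (C : ℕ → ℝ) (K : ℝ) (m τ : ℕ+) : ℝ :=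
  renewalRatio q C K m / q +
    ∑ x ∈ Finset.Ico (τ : ℕ) (m : ℕ), (renewalRatio q C K m - q * C x)

/-- The relative cost function of the threshold rule at a minimizer `m` of the renewal ratio. -/
noncomputable def thresholdValue (q : unitInterval) (C : ℕ → ℝ) (K : ℝ) (m : ℕ+) (x : State) : ℝ :=
  min K ((if x.2 then C x.1 else 0) + (K - thresholdGap q C K m (x.1 + 1))) - renewalRatio q C K m

lemma thresholdGap_of_ge {m τ : ℕ+} (hτ : m ≤ τ) :
    thresholdGap q C K m τ = renewalRatio q C K m / q := by
  rw [thresholdGap, Finset.Ico_eq_empty_of_le (by exact_mod_cast hτ), Finset.sum_empty, add_zero]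

lemma thresholdGap_of_lt {m τ : ℕ+} (hτ : τ < m) :
    thresholdGap q C K m τ =
      thresholdGap q C K m (τ + 1) + (renewalRatio q C K m - q * C τ) := by
  have : (τ : ℕ) < m := by exact_mod_cast hτ
  rw [thresholdGap, thresholdGap, Finset.sum_eq_sum_Ico_succ_bot this]
  push_cast
  ring

/-- The definition of the renewal ratio at `m`, rearranged. -/
lemma thresholdGap_one (hq : 0 < q) (m : ℕ+) : thresholdGap q C K m 1 = K := by
  have hq' : (0 : ℝ) < q := hq
  have hd := renewalRatio_denom_pos q m
  have hr : renewalRatio q C K m * ((m : ℝ) + (1 - (q : ℝ)) / (q : ℝ)) =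
      (q : ℝ) * ∑ x ∈ Finset.Ico 1 (m : ℕ), C x + K := by
    rw [renewalRatio, div_mul_cancel₀ _ hd.ne']
  have hm : ((m : ℕ) - 1 : ℕ) = (m : ℝ) - 1 := by
    rw [Nat.cast_sub m.pos]
    simp
  rw [thresholdGap, PNat.one_coe, Finset.sum_sub_distrib, Finset.sum_const, ← Finset.mul_sum,
    Nat.card_Ico, nsmul_eq_mul, hm]
  have hsplit : renewalRatio q C K m * ((m : ℝ) + (1 - (q : ℝ)) / (q : ℝ)) =
      renewalRatio q C K m / q + ((m : ℝ) - 1) * renewalRatio q C K m := by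
    field_simp
    ring
  linarith

variable (hmono : Monotone C) {m : ℕ+} (hm : m ∈ renewalArgmin q C K)
include hmono hm

lemma le_thresholdGap (τ : ℕ+) : renewalRatio q C K m / q ≤ thresholdGap q C K m τ := by
  refine le_add_of_nonneg_right (Finset.sum_nonneg fun x hx => sub_nonneg.2 ?_)
  have hx' := Finset.mem_Ico.1 hx
  exact le_renewalRatio_of_lt hmono hm (τ := ⟨x, τ.pos.trans_le hx'.1⟩) hx'.2

lemma requestMean_thresholdValue (hq : 0 < q) (hC0 : ∀ n, 0 ≤ C n) (hK : 0 < K) (τ : ℕ+) :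
    requestMean q (thresholdValue q C K m) τ = K - thresholdGap q C K m τ := by
  have hq' : (0 : ℝ) < q := hq
  have hr := renewalRatio_pos (q := q) hC0 hK m
  have hg := le_thresholdGap hmono hm (τ + 1)
  have hrq : 0 < renewalRatio q C K m / q := div_pos hr hq'
  simp only [requestMean, thresholdValue, if_true, Bool.false_eq_true, if_false, zero_add]
  rw [min_eq_right (show K - thresholdGap q C K m (τ + 1) ≤ K by linarith)]
  rcases lt_or_ge τ m with hτ | hτ
  · have h1 : C τ ≤ renewalRatio q C K m / q :=
      (le_div_iff₀' hq').2 (le_renewalRatio_of_lt hmono hm hτ)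
    rw [min_eq_right (by linarith), thresholdGap_of_lt hτ]
    ring
  · have h1 : renewalRatio q C K m / q ≤ C τ :=
      (div_le_iff₀' hq').2 (renewalRatio_le_of_ge hmono hm hτ)
    rw [thresholdGap_of_ge hτ, thresholdGap_of_ge (hτ.trans (PNat.lt_add_right τ 1).le),
      min_eq_left (by linarith)]
    field_simp
    ring

lemma isBellmanSolution_thresholdValue (hq : 0 < q) (hC0 : ∀ n, 0 ≤ C n) (hK : 0 < K) :
    IsBellmanSolution q C K (renewalRatio q C K m) (thresholdValue q C K m) ∧
      ∀ x, actionValue q C K (thresholdValue q C K m) x (thresholdRule m x) =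
        thresholdValue q C K m x + renewalRatio q C K m := by
  have hq' : (0 : ℝ) < q := hq
  have hr := renewalRatio_pos (q := q) hC0 hK m
  have hmean := requestMean_thresholdValue hmono hm hq hC0 hK
  have htrue : ∀ x, actionValue q C K (thresholdValue q C K m) x true = K := fun x => by
    simp [actionValue, stageCost, hmean, thresholdGap_one hq]
  have hfalse : ∀ x, actionValue q C K (thresholdValue q C K m) x false =
      (if x.2 then C x.1 else 0) + (K - thresholdGap q C K m (x.1 + 1)) := fun x => by
    simp [actionValue, stageCost, hmean]
  refine ⟨⟨?_, fun x => ?_⟩, ?_⟩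
  · -- The gap is antitone in `τ`, hence at most its value `K` at `1`.
    have hgap : ∀ τ, thresholdGap q C K m τ ≤ K := fun τ => by
      induction τ using PNat.recOn with
      | one => exact (thresholdGap_one hq m).le
      | succ τ ih =>
        rcases lt_or_ge τ m with hτ | hτ
        · have h1 := le_renewalRatio_of_lt hmono hm hτ
          have h2 := thresholdGap_of_lt (q := q) (C := C) (K := K) hτ
          linarith
        · rwa [thresholdGap_of_ge (hτ.trans (PNat.lt_add_right τ 1).le), ← thresholdGap_of_ge hτ]
    refine ⟨-renewalRatio q C K m, ?_⟩
    rintro _ ⟨x, rfl⟩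
    have h1 := hgap (x.1 + 1)
    have h2 : 0 ≤ if x.2 then C x.1 else 0 := by
      split_ifs
      exacts [hC0 _, le_rfl]
    have h3 := le_min hK.le (add_nonneg h2 (sub_nonneg.2 h1))
    simp only [thresholdValue]
    linarith
  · rw [htrue, hfalse, thresholdValue, sub_add_cancel]
  · rintro ⟨τ, s⟩
    have hg := le_thresholdGap hmono hm (τ + 1)
    have hrq : 0 < renewalRatio q C K m / q := div_pos hr hq'
    rw [thresholdValue, sub_add_cancel]
    by_cases hs : m ≤ τ ∧ s = true
    · obtain ⟨hτ, rfl⟩ := hs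
      have h1 : renewalRatio q C K m / q ≤ C τ :=
        (div_le_iff₀' hq').2 (renewalRatio_le_of_ge hmono hm hτ)
      rw [show thresholdRule m (τ, true) = true by simp [thresholdRule, hτ], htrue,
        thresholdGap_of_ge (hτ.trans (PNat.lt_add_right τ 1).le), min_eq_left]
      simp only [if_true]
      linarith
    · rw [show thresholdRule m (τ, s) = false by
        simpa [thresholdRule, Bool.and_eq_false_imp] using hs, hfalse, min_eq_right]
      cases s with
      | false => simp only [Bool.false_eq_true, if_false]; linarith
      | true =>
        have h1 : C τ ≤ renewalRatio q C K m / q :=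
          (le_div_iff₀' hq').2
            (le_renewalRatio_of_lt hmono hm (not_le.1 fun hτ => hs ⟨hτ, rfl⟩))
        simp only [if_true]
        linarith

end Existence

/-! ### The rule of an arbitrary Bellman solution -/

lemma pnat_backward_induction {P : ℕ+ → Prop} (N : ℕ) (hN : ∀ τ : ℕ+, N ≤ τ → P τ)
    (hstep : ∀ τ, P (τ + 1) → P τ) (τ : ℕ+) : P τ := by
  have key : ∀ (k : ℕ) (τ : ℕ+), N ≤ τ + k → P τ := by
    intro k
    induction k with
    | zero => exact fun τ h => hN τ h
    | succ k ih =>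
      intro τ h
      refine hstep τ (ih _ ?_)
      push_cast
      omega
  exact key N τ (Nat.le_add_left _ _)

/-- A bounded sequence whose terms are eventually contractions of their successors eventually
vanishes. -/
lemma eq_zero_of_le_mul_succ {d : ℕ+ → ℝ} {r M : ℝ} (hr0 : 0 ≤ r) (hr1 : r < 1) (N : ℕ)
    (hM : ∀ τ, |d τ| ≤ M) (hd : ∀ τ : ℕ+, N ≤ τ → |d τ| ≤ r * |d (τ + 1)|) (τ : ℕ+) (hτ : N ≤ τ) :
    d τ = 0 := by
  have key : ∀ (k : ℕ) (τ : ℕ+), N ≤ τ → |d τ| ≤ r ^ k * M := by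
    intro k
    induction k with
    | zero => intro τ _; simpa using hM τ
    | succ k ih =>
      intro τ hτ
      have h1 := ih (τ + 1) (by push_cast; omega)
      calc |d τ| ≤ r * |d (τ + 1)| := hd τ hτ
        _ ≤ r * (r ^ k * M) := mul_le_mul_of_nonneg_left h1 hr0
        _ = r ^ (k + 1) * M := by ring
  have hlim : Tendsto (fun k : ℕ => r ^ k * M) atTop (𝓝 0) := by
    simpa using (tendsto_pow_atTop_nhds_zero_of_lt_one hr0 hr1).mul_const M
  exact abs_nonpos_iff.1 (ge_of_tendsto' hlim fun k => key k τ hτ)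

section Rule

variable {q : unitInterval} {C : ℕ → ℝ} {K θ : ℝ} {h : State → ℝ}

lemma requestMean_le {c : ℝ} (hc : ∀ x, h x ≤ c) (τ : ℕ+) : requestMean q h τ ≤ c := by
  have h1 := mul_le_mul_of_nonneg_left (hc (τ, true)) q.2.1
  have h2 := mul_le_mul_of_nonneg_left (hc (τ, false)) (sub_nonneg.2 q.2.2)
  unfold requestMean
  linarith

lemma le_requestMean {c : ℝ} (hc : ∀ x, c ≤ h x) (τ : ℕ+) : c ≤ requestMean q h τ := by
  have h1 := mul_le_mul_of_nonneg_left (hc (τ, true)) q.2.1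
  have h2 := mul_le_mul_of_nonneg_left (hc (τ, false)) (sub_nonneg.2 q.2.2)
  unfold requestMean
  linarith

/-- The Bellman equation averaged over the request. -/
lemma IsBellmanSolution.requestMean_add (hs : IsBellmanSolution q C K θ h) (τ : ℕ+) :
    requestMean q h τ + θ =
      q * min (K + requestMean q h 1) (C τ + requestMean q h (τ + 1)) +
        (1 - q) * min (K + requestMean q h 1) (requestMean q h (τ + 1)) := by
  have h1 := hs.2 (τ, true)
  have h2 := hs.2 (τ, false)
  simp only [actionValue, stageCost, if_true, Bool.false_eq_true, if_false, zero_add] at h1 h2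
  rw [← h1, ← h2, requestMean]
  ring

/-- For a nonpositive fetch cost, `h_av` is constant in every Bellman solution: it is at most
`h_av 1`, and once `C` is large the difference `d` satisfies `|d τ| ≤ (1 - q) |d (τ + 1)|`, so it
vanishes eventually, and then everywhere by backward induction. -/
lemma IsBellmanSolution.requestMean_eq_of_nonpos (hs : IsBellmanSolution q C K K h) (hq : 0 < q)
    (hC0 : ∀ n, 0 ≤ C n) (hC : Tendsto C atTop atTop) (hK : K ≤ 0) (τ : ℕ+) :
    requestMean q h τ = requestMean q h 1 := by
  have hq' : (0 : ℝ) < q := hq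
  have hq1 : 0 ≤ 1 - (q : ℝ) := sub_nonneg.2 q.2.2
  obtain ⟨b, hb⟩ := hs.1
  have hlow : ∀ σ, b ≤ requestMean q h σ := le_requestMean fun y => hb ⟨y, rfl⟩
  have hup : ∀ σ, requestMean q h σ ≤ requestMean q h 1 := fun σ => by
    have := requestMean_le (q := q) hs.le_fetch σ
    linarith
  have hlow' : ∀ σ, (1 - (q : ℝ)) * (K + requestMean q h (σ + 1)) ≤
      (1 - (q : ℝ)) * min (K + requestMean q h 1) (requestMean q h (σ + 1)) := fun σ =>
    mul_le_mul_of_nonneg_left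
      (le_min (by linarith [hup (σ + 1)]) (by linarith)) hq1
  obtain ⟨N, hN⟩ := eventually_atTop.1 (hC.eventually_ge_atTop (K + requestMean q h 1 - b))
  refine pnat_backward_induction (P := fun σ => requestMean q h σ = requestMean q h 1) N
    (fun σ hσ => ?_) (fun σ hσ => ?_) τ
  · refine sub_eq_zero.1 (eq_zero_of_le_mul_succ
      (d := fun σ => requestMean q h σ - requestMean q h 1) (M := requestMean q h 1 - b)
      hq1 (by linarith) N (fun σ => ?_) (fun σ hσ => ?_) σ hσ)
    · rw [abs_of_nonpos (by linarith [hup σ])]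
      linarith [hlow σ]
    · have h1 := hs.requestMean_add σ
      have h2 := hlow' σ
      rw [min_eq_left (show K + requestMean q h 1 ≤ C σ + requestMean q h (σ + 1) by
        linarith [hN _ hσ, hlow (σ + 1)])] at h1
      rw [abs_of_nonpos (by linarith [hup σ]), abs_of_nonpos (by linarith [hup (σ + 1)])]
      linarith
  · have h1 := hs.requestMean_add σ
    rw [hσ, min_eq_left (by linarith [hC0 σ]), min_eq_left (by linarith)] at h1
    linarith

lemma IsBellmanSolution.isBellmanRule_alwaysFetch (hs : IsBellmanSolution q C K K h) (hq : 0 < q)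
    (hC0 : ∀ n, 0 ≤ C n) (hC : Tendsto C atTop atTop) (hK : K ≤ 0) :
    IsBellmanRule q C K h alwaysFetch := by
  intro x
  have h1 := hs.requestMean_eq_of_nonpos hq hC0 hC hK (x.1 + 1)
  have h2 : 0 ≤ if x.2 then C x.1 else 0 := by
    split_ifs
    exacts [hC0 _, le_rfl]
  simp only [alwaysFetch, actionValue, stageCost, if_true, Bool.false_eq_true, if_false, true_iff,
    h1]
  linarith

section Gap

variable (hs : IsBellmanSolution q C K θ h) (hθ : 0 < θ)
include hs hθ

/-- The Bellman equation in terms of the gap `K + h_av 1 - h_av τ`. Since `θ > 0`, fetching without a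
request is never optimal. -/
lemma IsBellmanSolution.gap_eq (τ : ℕ+) :
    K + requestMean q h 1 - requestMean q h τ =
      θ + (K + requestMean q h 1 - requestMean q h (τ + 1)) -
        q * min (K + requestMean q h 1 - requestMean q h (τ + 1)) (C τ) := by
  have h1 := hs.requestMean_add τ
  have h2 := requestMean_le (q := q) hs.le_fetch (τ + 1)
  rw [min_eq_right (show requestMean q h (τ + 1) ≤ K + requestMean q h 1 by linarith)] at h1
  have h3 : min (K + requestMean q h 1) (C τ + requestMean q h (τ + 1)) =
      min (K + requestMean q h 1 - requestMean q h (τ + 1)) (C τ) + requestMean q h (τ + 1) := by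
    rw [← min_add_add_right, sub_add_cancel]
  rw [h3] at h1
  linarith

/-- The only bounded solution of the recursion `v τ = θ + (1 - q) v (τ + 1)` is `θ / q`. -/
lemma IsBellmanSolution.eventually_gap_eq (hq : 0 < q) (hC : Tendsto C atTop atTop) :
    ∃ N : ℕ, ∀ τ : ℕ+, N ≤ τ → K + requestMean q h 1 - requestMean q h τ = θ / q := by
  have hq' : (0 : ℝ) < q := hq
  have hq1 : 0 ≤ 1 - (q : ℝ) := sub_nonneg.2 q.2.2
  obtain ⟨b, hb⟩ := hs.1
  have hlow : ∀ σ, b ≤ requestMean q h σ := le_requestMean fun y => hb ⟨y, rfl⟩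
  have hup : ∀ σ, θ ≤ K + requestMean q h 1 - requestMean q h σ := fun σ => by
    have := requestMean_le (q := q) hs.le_fetch σ
    linarith
  obtain ⟨N, hN⟩ := eventually_atTop.1 (hC.eventually_ge_atTop (K + requestMean q h 1 - b))
  refine ⟨N, fun τ hτ => sub_eq_zero.1 (eq_zero_of_le_mul_succ
    (d := fun σ => K + requestMean q h 1 - requestMean q h σ - θ / q)
    (M := K + requestMean q h 1 - b + θ / q) hq1 (by linarith) N (fun σ => ?_)
    (fun σ hσ => le_of_eq ?_) τ hτ)⟩
  · have : 0 < θ / q := div_pos hθ hq'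
    rw [abs_le]
    constructor <;> linarith [hup σ, hlow σ]
  · have h1 := hs.gap_eq hθ σ
    rw [min_eq_left (by linarith [hN _ hσ, hlow (σ + 1)])] at h1
    rw [h1, ← abs_of_nonneg hq1, ← abs_mul]
    congr 1
    field_simp
    ring

lemma IsBellmanSolution.le_gap (hq : 0 < q) (hC : Tendsto C atTop atTop) (τ : ℕ+) :
    θ / q ≤ K + requestMean q h 1 - requestMean q h τ := by
  have hq' : (0 : ℝ) < q := hq
  have hq1 : 0 ≤ 1 - (q : ℝ) := sub_nonneg.2 q.2.2
  obtain ⟨N, hN⟩ := hs.eventually_gap_eq hθ hq hC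
  refine pnat_backward_induction
    (P := fun τ => θ / q ≤ K + requestMean q h 1 - requestMean q h τ) N
    (fun σ hσ => (hN σ hσ).ge) (fun σ hσ => ?_) τ
  have h1 := hs.gap_eq hθ σ
  have h2 := mul_le_mul_of_nonneg_left
    (min_le_left (K + requestMean q h 1 - requestMean q h (σ + 1)) (C σ)) hq'.le
  have h3 := mul_le_mul_of_nonneg_left hσ hq1
  have h4 : (1 - (q : ℝ)) * (θ / q) = θ / q - θ := by
    field_simp
  linarith

lemma IsBellmanSolution.gap_eq_of_le (hq : 0 < q) (hmono : Monotone C)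
    (hC : Tendsto C atTop atTop) (τ : ℕ+) (hτ : θ ≤ q * C τ) :
    K + requestMean q h 1 - requestMean q h τ = θ / q := by
  have hq' : (0 : ℝ) < q := hq
  obtain ⟨N, hN⟩ := hs.eventually_gap_eq hθ hq hC
  refine pnat_backward_induction
    (P := fun τ => θ ≤ q * C τ → K + requestMean q h 1 - requestMean q h τ = θ / q) N
    (fun σ hσ _ => hN σ hσ) (fun σ ih hσ => ?_) τ hτ
  have hle : C σ ≤ C (σ + 1 : ℕ+) := hmono (PNat.lt_add_right σ 1).le
  have h1 := hs.gap_eq hθ σ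
  rw [ih (hσ.trans (mul_le_mul_of_nonneg_left hle hq'.le)),
    min_eq_left ((div_le_iff₀' hq').2 hσ), mul_div_cancel₀ _ hq'.ne'] at h1
  linarith

/-- Every Bellman solution prescribes to fetch iff there is a request and `q C τ ≥ θ`. -/
lemma IsBellmanSolution.actionValue_le_iff (hq : 0 < q) (hmono : Monotone C)
    (hC : Tendsto C atTop atTop) (x : State) :
    actionValue q C K h x true ≤ actionValue q C K h x false ↔ x.2 = true ∧ θ ≤ q * C x.1 := by
  have hq' : (0 : ℝ) < q := hq
  obtain ⟨τ, s⟩ := x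
  have hg := hs.le_gap hθ hq hC (τ + 1)
  have hθq : 0 < θ / q := div_pos hθ hq'
  cases s with
  | false =>
    simp only [actionValue, stageCost, if_true, Bool.false_eq_true, if_false, false_and, iff_false]
    linarith
  | true =>
    simp only [actionValue, stageCost, if_true, Bool.false_eq_true, if_false, true_and]
    constructor
    · intro hle
      exact (div_le_iff₀' hq').1 (by linarith)
    · intro hle
      have hle' : C τ ≤ C (τ + 1 : ℕ+) := hmono (PNat.lt_add_right τ 1).le
      have h1 := hs.gap_eq_of_le hθ hq hmono hC (τ + 1)
        (hle.trans (mul_le_mul_of_nonneg_left hle' hq'.le))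
      have h2 := (div_le_iff₀' hq').2 hle
      linarith

end Gap

lemma IsBellmanSolution.isBellmanRule_thresholdRule {m : ℕ+} (hm : IsLeast (renewalArgmin q C K) m)
    (hs : IsBellmanSolution q C K (renewalRatio q C K m) h) (hq : 0 < q) (hC0 : ∀ n, 0 ≤ C n)
    (hmono : Monotone C) (hC : Tendsto C atTop atTop) (hK : 0 < K) :
    IsBellmanRule q C K h (thresholdRule m) := by
  intro x
  rw [hs.actionValue_le_iff (renewalRatio_pos hC0 hK m) hq hmono hC]
  simp only [thresholdRule, Bool.and_eq_true, decide_eq_true_eq]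
  rw [and_comm, and_congr_right_iff]
  refine fun _ => ⟨fun hle => renewalRatio_le_of_ge hmono hm.1 hle, fun hle => ?_⟩
  by_contra hlt
  exact absurd hle (not_le.2 (lt_renewalRatio_of_lt_isLeast hmono hm (not_le.1 hlt)))

end Rule

end SingleUserFetch

/-! ### Optimal costs and policies -/

open SingleUserFetch in
theorem mainTheorem3
    (ca : ℕ → ℝ) (ca_nonneg : 0 ≤ ca 0) (ca_strictMono : StrictMono ca)
    (ca_convex : ∀ n : ℕ, ca (n + 1) - ca n ≤ ca (n + 2) - ca (n + 1))
    (p q : unitInterval) (hp : 0 < p) (hq : 0 < q) (α Cf lam : ℝ) :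
    ∃ θ : ℝ,
      -- the Bellman equation is solvable, and only with the constant `θ`
      (∃ h, IsBellmanSolution q (avgAgeCost ca p) (α * Cf + lam) θ h) ∧
      (∀ θ' h, IsBellmanSolution q (avgAgeCost ca p) (α * Cf + lam) θ' h → θ' = θ) ∧
      -- nonpositive fetch cost
      (α * Cf + lam ≤ 0 →
        IsAverageOptimal q (avgAgeCost ca p) (α * Cf + lam) θ (stationary alwaysFetch) ∧
        ∀ h, IsBellmanSolution q (avgAgeCost ca p) (α * Cf + lam) θ h →
          IsBellmanRule q (avgAgeCost ca p) (α * Cf + lam) h alwaysFetch) ∧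
      -- positive fetch cost
      (0 < α * Cf + lam →
        (renewalArgmin q (avgAgeCost ca p) (α * Cf + lam)).Nonempty ∧
        (∀ m ∈ renewalArgmin q (avgAgeCost ca p) (α * Cf + lam),
          IsAverageOptimal q (avgAgeCost ca p) (α * Cf + lam) θ (stationary (thresholdRule m))) ∧
        ∀ m, IsLeast (renewalArgmin q (avgAgeCost ca p) (α * Cf + lam)) m →
          ∀ h, IsBellmanSolution q (avgAgeCost ca p) (α * Cf + lam) θ h →
            IsBellmanRule q (avgAgeCost ca p) (α * Cf + lam) h (thresholdRule m)) := by
  have hC0 : ∀ n, 0 ≤ avgAgeCost ca p n := avgAgeCost_nonneg ca_nonneg ca_strictMono.monotone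
  have hmono : Monotone (avgAgeCost ca p) := avgAgeCost_monotone ca_strictMono.monotone ca_convex
  have hC : Tendsto (avgAgeCost ca p) atTop atTop :=
    avgAgeCost_tendsto_atTop ca_nonneg ca_strictMono ca_convex hp
  generalize α * Cf + lam = K
  rcases le_or_gt K 0 with hK | hK
  · obtain ⟨hs, hμ⟩ := isBellmanSolution_zero (q := q) hC0 hK
    refine ⟨K, ⟨_, hs⟩, fun θ' h' hs' => hs.constant_unique hs', fun _ => ⟨hs.isAverageOptimal hμ,
      fun h' hs' => hs'.isBellmanRule_alwaysFetch hq hC0 hC hK⟩, fun hK' => ?_⟩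
    exact absurd hK' (not_lt.2 hK)
  · have hne : (renewalArgmin q (avgAgeCost ca p) K).Nonempty := renewalArgmin_nonempty hq hC
    obtain ⟨m₀, hm₀⟩ := hne
    have hval : ∀ m ∈ renewalArgmin q (avgAgeCost ca p) K,
        renewalRatio q (avgAgeCost ca p) K m₀ = renewalRatio q (avgAgeCost ca p) K m :=
      fun m hm => le_antisymm (hm₀ m) (hm m₀)
    have hs₀ := (isBellmanSolution_thresholdValue hmono hm₀ hq hC0 hK).1
    refine ⟨renewalRatio q (avgAgeCost ca p) K m₀, ⟨_, hs₀⟩,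
      fun θ' h' hs' => hs₀.constant_unique hs', fun hK' => absurd hK (not_lt.2 hK'),
      fun _ => ⟨⟨m₀, hm₀⟩, fun m hm => ?_, fun m hm h' hs' => ?_⟩⟩
    · obtain ⟨hs, hμ⟩ := isBellmanSolution_thresholdValue hmono hm hq hC0 hK
      rw [hval m hm]
      exact hs.isAverageOptimal hμ
    · rw [hval m hm.1] at hs'
      exact hs'.isBellmanRule_thresholdRule hm hq hC0 hmono hC hK
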